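/- Consider Bernoulli stochastic probing on a ground set $U=[n]$: each element $i\in U$ is independently active with a known probability $p_i\in[0,1]$. One is given a nonempty prefix-closed family $\mathcal F$ of sequences of distinct elements of $U$ (every prefix of a sequence in $\mathcal F$ is in $\mathcal F$) and an XOS objective $f:2^U\to\mathbb R_{\ge 0}$, i.e. there are finitely many (at least one) weight vectors $w^{(1)},\dots,w^{(W)}\in\mathbb R_{\ge 0}^U$ with $f(S)=\max_{k\in[W]}\sum_{j\in S}w^{(k)}_j$ for all $S\subseteq U$. Probing an element reveals whether it is active; if the probed elements form the set $P$, the reward is $f(\mathrm{Ac}(P))$, where $\mathrm{Ac}(P)$ is the set of active elements of $P$. An adaptive strategy is a binary decision tree whose internal nodes are labelled by elements to probe, with a Yes arc (element active) and a No arc (element not active), such that the elements along each root-to-leaf path form a sequence in $\mathcal F$; a non-adaptive strategy is a single sequence in $\mathcal F$, fixed in advance and probed entirely. The adaptivity gap of the instance is the maximum expected reward of an adaptive strategy divided by the maximum expected reward of a non-adaptive strategy (with $0/0=0$ and $a/0=\infty$ for $a>0$). Let $\Lambda_{\mathrm{xos}}(n,r)$ be the supremum of the adaptivity gap over all such instances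 with $|U|=n$ in which every sequence in $\mathcal F$ has length at most $r$. Then there is an absolute constant $C>0$ such that for all integers $2\le r\le n$, $$\Lambda_{\mathrm{xos}}(n,r)\le C\,\log_2 r\,\log_2 n .$$ -/

import Mathlib

open scoped ENNReal

/-- An adaptive strategy tree on the ground set `Fin n`: an internal node carries the element that
is probed, followed by the subtree at its Yes arc (the element is active) and the subtree at its
No arc (the element is not active). A leaf terminates the probing. -/
inductive StrategyTree (n : ℕ) : Type
  | leaf : StrategyTree n
  | node (i : Fin n) (yes no : StrategyTree n) : StrategyTree n

/-- A root-to-leaf path: the probed elements in order, each with the arc taken (`true` = Yes). -/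
abbrev ProbePath (n : ℕ) : Type := List (Fin n × Bool)

/-- The sequence of elements probed along a path. -/
def ProbePath.elements {n : ℕ} (l : ProbePath n) : List (Fin n) := l.map Prod.fst

/-- The set of active elements on a path, those at which the Yes arc is taken. -/
def ProbePath.active {n : ℕ} (l : ProbePath n) : Finset (Fin n) :=
  ((l.filter fun a => a.2).map Prod.fst).toFinset

/-- The probability of following a path when element `i` is active with probability `p i`:
the product of the probabilities of its arcs. -/
noncomputable def ProbePath.prob {n : ℕ} (p : Fin n → ℝ) (l : ProbePath n) : ℝ :=
  (l.map fun a => if a.2 then p a.1 else 1 - p a.1).prod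

/-- The leaves of a tree, each one given by its root-to-leaf path (paths of different leaves are
different). -/
def StrategyTree.leaves {n : ℕ} : StrategyTree n → List (ProbePath n)
  | .leaf => [[]]
  | .node i yes no =>
      yes.leaves.map (fun l => (i, true) :: l) ++ no.leaves.map (fun l => (i, false) :: l)

/-- A set function `f` is XOS: a maximum of finitely many (at least one, since the maximum is
attained) non-negative additive functions. -/
def IsXOS {n : ℕ} (f : Finset (Fin n) → ℝ) : Prop :=
  ∃ (W : ℕ) (w : Fin W → Fin n → ℝ), (∀ k j, 0 ≤ w k j) ∧
    ∀ S : Finset (Fin n), IsGreatest (Set.range fun k => ∑ j ∈ S, w k j) (f S)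

/-- An instance of Bernoulli stochastic probing on the ground set `Fin n`: the elements are
independently active, `i` with probability `p i`, the probed sequence has to lie in the
prefix-closed family `feasible` of sequences of distinct elements, and the reward is `f` of the set
of probed active elements. -/
structure BernoulliProbing (n : ℕ) where
  p : Fin n → ℝ
  p_nonneg : ∀ i, 0 ≤ p i
  p_le_one : ∀ i, p i ≤ 1
  feasible : Set (List (Fin n))
  nonempty : feasible.Nonempty
  nodup : ∀ s ∈ feasible, s.Nodup
  prefix_closed : ∀ s ∈ feasible, ∀ t, t <+: s → t ∈ feasible
  f : Finset (Fin n) → ℝ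

namespace BernoulliProbing

variable {n : ℕ} (I : BernoulliProbing n)

/-- A tree is an admissible adaptive strategy if all its root-to-leaf paths are feasible (in
particular no element is repeated on a path). -/
def IsAdaptiveStrategy (T : StrategyTree n) : Prop :=
  ∀ l ∈ T.leaves, l.elements ∈ I.feasible

/-- The expected reward of the adaptive strategy `T`: the expectation of `f` of the active elements
on the path to a leaf, over the leaf distribution of `T`. -/
noncomputable def adap (T : StrategyTree n) : ℝ :=
  (T.leaves.map fun l => l.prob I.p * I.f l.active).sum

/-- The probability that `R` is exactly the set of active elements of the ground set. -/
noncomputable def activeProb (R : Finset (Fin n)) : ℝ :=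
  ∏ i, if i ∈ R then I.p i else 1 - I.p i

/-- The expected reward of the non-adaptive strategy that probes all elements of the sequence `s`:
the expectation of `f` of the active elements among those of `s`. -/
noncomputable def nonadap (s : List (Fin n)) : ℝ :=
  ∑ R : Finset (Fin n), I.activeProb R * I.f (R ∩ s.toFinset)

/-- The optimal expected reward of an adaptive strategy. -/
noncomputable def optAdap : ℝ≥0∞ :=
  ⨆ (T : StrategyTree n) (_ : I.IsAdaptiveStrategy T), ENNReal.ofReal (I.adap T)

/-- The optimal expected reward of a non-adaptive strategy. -/
noncomputable def optNonadap : ℝ≥0∞ :=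
  ⨆ s ∈ I.feasible, ENNReal.ofReal (I.nonadap s)

/-- The adaptivity gap of an instance. In `ℝ≥0∞` one has `0 / 0 = 0` and `a / 0 = ∞` for `a ≠ 0`,
so a finite bound `optAdap / optNonadap ≤ c` means `optAdap ≤ c * optNonadap`. -/
noncomputable def adaptivityGap : ℝ≥0∞ := I.optAdap / I.optNonadap

end BernoulliProbing

/-- The supremum of the adaptivity gap over all instances of Bernoulli stochastic probing with `n`
elements, an XOS objective, and a prefix-closed constraint whose sequences have length at most
`r`. -/
noncomputable def gapXOS (n r : ℕ) : ℝ≥0∞ :=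
  ⨆ (I : BernoulliProbing n) (_ : IsXOS I.f) (_ : ∀ s ∈ I.feasible, s.length ≤ r),
    I.adaptivityGap

/-! Let `B` > 0 bound every non-adaptive value. Run the tree, and for each probed element also draw
a fresh independent state. Given the path, the fresh active set `R` is a non-adaptive sample, so
f(R) has mean at most `B`. It remains to compare the active set `A` that steers the tree with `R`.

The weights are cut at `B`: singleton values above 2B, about log r dyadic scales B/2^i, and a
remainder of at most 2B/r per element. Large values and remainder are bounded by fixed additive
functions, for which adaptivity gains nothing beyond the largest compensator of a path
(`jointExp_sum_fst_le`); `sum_mul_largeValue_le` bounds the large part of that compensator by 2B.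

Each scale is the rank function of a set family, and `jointExp_coverRank_le` compares the ranks of
`A` and `R` at the loss of a factor log n. It rests on E[2^rank(A) (2n)^(-rank(R))] ≤ 3, followed by
log x ≤ x - 1. The moment bound (`jointExp_two_pow_coverRank_le`) is a sum over sets `G` contained
in a member of the family, hence independent of the number of members. A probe that can raise the
rank multiplies the moment by at most 1 + p, which the probability 1 - p that the fresh state is
inactive absorbs; otherwise the probe is charged to `G`. -/

open Finset

/-! ### Coupled expectations on trees and lists -/

namespace StrategyTree

variable {n : ℕ}

/-- The expectation of `h A R`, where `A` is the set of active elements found by the tree and `R`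
is an independent fresh sample of the active elements among those that the tree probes. -/
noncomputable def jointExp (p : Fin n → ℝ) :
    StrategyTree n → (Finset (Fin n) → Finset (Fin n) → ℝ) → ℝ
  | .leaf, h => h ∅ ∅
  | .node i yes no, h =>
      p i * (p i * jointExp p yes (fun A R => h (insert i A) (insert i R)) +
        (1 - p i) * jointExp p yes (fun A R => h (insert i A) R)) +
      (1 - p i) * (p i * jointExp p no (fun A R => h A (insert i R)) +
        (1 - p i) * jointExp p no h)

end StrategyTree

/-- The expectation of `h R`, where `R` is the set of active elements in the list. -/
noncomputable def listExp {n : ℕ} (p : Fin n → ℝ) : List (Fin n) → (Finset (Fin n) → ℝ) → ℝ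
  | [], h => h ∅
  | i :: s, h => p i * listExp p s (fun R => h (insert i R)) + (1 - p i) * listExp p s h

/-! ### Non-adaptive expectations -/

section ListExp

variable {n : ℕ} {p : Fin n → ℝ}

theorem listExp_mono (h0 : ∀ i, 0 ≤ p i) (h1 : ∀ i, p i ≤ 1) (s : List (Fin n)) :
    ∀ {g h : Finset (Fin n) → ℝ}, (∀ R, g R ≤ h R) → listExp p s g ≤ listExp p s h := by
  induction s with
  | nil => intro g h hgh; exact hgh ∅
  | cons i s ih =>
    intro g h hgh
    have := sub_nonneg.2 (h1 i)
    have := h0 i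
    simp only [listExp]
    gcongr
    · exact ih fun R => hgh _
    · exact ih hgh

theorem listExp_const (s : List (Fin n)) (c : ℝ) : listExp p s (fun _ => c) = c := by
  induction s with
  | nil => rfl
  | cons i s ih => simp only [listExp, ih]; ring

theorem listExp_const_mul (s : List (Fin n)) (c : ℝ) :
    ∀ h : Finset (Fin n) → ℝ, listExp p s (fun R => c * h R) = c * listExp p s h := by
  induction s with
  | nil => intro h; rfl
  | cons i s ih => intro h; simp only [listExp, ih]; ring

theorem listExp_add (s : List (Fin n)) :
    ∀ g h : Finset (Fin n) → ℝ,
      listExp p s (fun R => g R + h R) = listExp p s g + listExp p s h := by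
  induction s with
  | nil => intro g h; rfl
  | cons i s ih => intro g h; simp only [listExp, ih]; ring

/-- Conditioning on the state of an element that is not in `S`. -/
theorem sum_activeProb_insert (I : BernoulliProbing n) {i : Fin n} {S : Finset (Fin n)}
    (hi : i ∉ S) (h : Finset (Fin n) → ℝ) :
    ∑ R, I.activeProb R * h (R ∩ insert i S) =
      I.p i * ∑ R, I.activeProb R * h (insert i (R ∩ S)) +
        (1 - I.p i) * ∑ R, I.activeProb R * h (R ∩ S) := by
  -- Subsets are paired as `R` and `insert i R` with `i ∉ R`, which factors out the state of `i`.
  have key : ∀ H : Finset (Fin n) → ℝ, ∑ R, I.activeProb R * H R =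
      ∑ R ∈ (univ.erase i).powerset, (∏ j ∈ univ.erase i, if j ∈ R then I.p j else 1 - I.p j) *
        ((1 - I.p i) * H R + I.p i * H (insert i R)) := by
    intro H
    have hu : (univ : Finset (Finset (Fin n))) = (insert i (univ.erase i)).powerset := by
      rw [insert_erase (mem_univ i), powerset_univ]
    rw [hu, sum_powerset_insert (notMem_erase i univ), ← sum_add_distrib]
    refine sum_congr rfl fun R hR => ?_
    have hiR : i ∉ R := fun hh => notMem_erase i univ (mem_powerset.1 hR hh)
    have e1 : I.activeProb R =
        (1 - I.p i) * ∏ j ∈ univ.erase i, if j ∈ R then I.p j else 1 - I.p j := by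
      rw [BernoulliProbing.activeProb, ← mul_prod_erase univ _ (mem_univ i), if_neg hiR]
    have e2 : I.activeProb (insert i R) =
        I.p i * ∏ j ∈ univ.erase i, if j ∈ R then I.p j else 1 - I.p j := by
      rw [BernoulliProbing.activeProb, ← mul_prod_erase univ _ (mem_univ i),
        if_pos (mem_insert_self i R)]
      congr 1
      refine prod_congr rfl fun j hj => ?_
      simp [mem_insert, (mem_erase.1 hj).1]
    rw [e1, e2]
    ring
  rw [key (fun R => h (R ∩ insert i S)), key (fun R => h (insert i (R ∩ S))),
    key (fun R => h (R ∩ S)), mul_sum, mul_sum, ← sum_add_distrib]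
  refine sum_congr rfl fun R hR => ?_
  have hiR : i ∉ R := fun hh => notMem_erase i univ (mem_powerset.1 hR hh)
  simp only [inter_insert_of_notMem hiR, insert_inter_of_notMem hi, ← insert_inter_distrib]
  ring

theorem sum_activeProb_eq_listExp (I : BernoulliProbing n) (s : List (Fin n)) :
    s.Nodup → ∀ h : Finset (Fin n) → ℝ,
      ∑ R, I.activeProb R * h (R ∩ s.toFinset) = listExp I.p s h := by
  induction s with
  | nil =>
    intro _ h
    have hs : ∑ R, I.activeProb R = 1 := by
      have := Fintype.prod_add I.p (fun i => 1 - I.p i)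
      simp only [add_sub_cancel, prod_const_one] at this
      rw [this]
      refine sum_congr rfl fun R _ => ?_
      rw [BernoulliProbing.activeProb, prod_ite]
      congr 1
      · exact prod_congr (by ext; simp) fun _ _ => rfl
      · exact prod_congr (by ext; simp) fun _ _ => rfl
    simp [listExp, ← sum_mul, hs]
  | cons i s ih =>
    intro hs h
    obtain ⟨hi, hs⟩ := List.nodup_cons.1 hs
    rw [List.toFinset_cons, sum_activeProb_insert I (by simpa using hi), listExp,
      ih hs (fun R => h (insert i R)), ih hs h]

theorem nonadap_eq_listExp (I : BernoulliProbing n) {s : List (Fin n)} (hs : s.Nodup) :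
    I.nonadap s = listExp I.p s I.f :=
  sum_activeProb_eq_listExp I s hs I.f

end ListExp

/-! ### Adaptive expectations and the fresh sample -/

namespace StrategyTree

variable {n : ℕ} {p : Fin n → ℝ}

theorem leaves_ne_nil (T : StrategyTree n) : T.leaves ≠ [] := by
  induction T with
  | leaf => simp [leaves]
  | node i yes no ihy _ => simp [leaves, ihy]

theorem jointExp_mono (h0 : ∀ i, 0 ≤ p i) (h1 : ∀ i, p i ≤ 1) (T : StrategyTree n) :
    ∀ {g h : Finset (Fin n) → Finset (Fin n) → ℝ}, (∀ A R, g A R ≤ h A R) →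
      jointExp p T g ≤ jointExp p T h := by
  induction T with
  | leaf => intro g h hgh; exact hgh ∅ ∅
  | node i yes no ihy ihn =>
    intro g h hgh
    have := sub_nonneg.2 (h1 i)
    have := h0 i
    simp only [jointExp]
    gcongr
    · exact ihy fun A R => hgh _ _
    · exact ihy fun A R => hgh _ _
    · exact ihn fun A R => hgh _ _
    · exact ihn fun A R => hgh _ _

theorem jointExp_const (T : StrategyTree n) (c : ℝ) : jointExp p T (fun _ _ => c) = c := by
  induction T with
  | leaf => rfl
  | node i yes no ihy ihn => simp only [jointExp, ihy, ihn]; ring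

theorem jointExp_const_mul (T : StrategyTree n) (c : ℝ) :
    ∀ h : Finset (Fin n) → Finset (Fin n) → ℝ,
      jointExp p T (fun A R => c * h A R) = c * jointExp p T h := by
  induction T with
  | leaf => intro h; rfl
  | node i yes no ihy ihn => intro h; simp only [jointExp, ihy, ihn]; ring

theorem jointExp_add (T : StrategyTree n) :
    ∀ g h : Finset (Fin n) → Finset (Fin n) → ℝ,
      jointExp p T (fun A R => g A R + h A R) = jointExp p T g + jointExp p T h := by
  induction T with
  | leaf => intro g h; rfl
  | node i yes no ihy ihn => intro g h; simp only [jointExp, ihy, ihn]; ring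

theorem jointExp_sum {ι : Type*} (T : StrategyTree n) (s : Finset ι)
    (h : ι → Finset (Fin n) → Finset (Fin n) → ℝ) :
    jointExp p T (fun A R => ∑ i ∈ s, h i A R) = ∑ i ∈ s, jointExp p T (h i) := by
  classical
  induction s using Finset.induction_on with
  | empty => simpa using jointExp_const T 0
  | insert a s ha ih => simp only [sum_insert ha, jointExp_add, ih]

theorem active_cons_true (i : Fin n) (l : ProbePath n) :
    ProbePath.active ((i, true) :: l) = insert i l.active := by
  simp [ProbePath.active]

theorem active_cons_false (i : Fin n) (l : ProbePath n) :
    ProbePath.active ((i, false) :: l) = l.active := by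
  simp [ProbePath.active]

theorem sum_leaves_eq_jointExp (T : StrategyTree n) :
    ∀ h : Finset (Fin n) → ℝ,
      (T.leaves.map fun l => l.prob p * h l.active).sum = jointExp p T (fun A _ => h A) := by
  induction T with
  | leaf => intro h; simp [leaves, jointExp, ProbePath.prob, ProbePath.active]
  | node i yes no ihy ihn =>
    intro h
    have e1 := ihy (fun A => h (insert i A))
    have e2 := ihn h
    simp only [leaves, List.map_append, List.map_map, List.sum_append, jointExp, ← e1, ← e2,
      Function.comp_def, active_cons_true, active_cons_false, ProbePath.prob, List.map_cons,
      List.prod_cons, if_true, Bool.false_eq_true, if_false, mul_assoc, List.sum_map_mul_left]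
    ring

theorem forall_leaves_node {P : ProbePath n → Prop} {i : Fin n} {yes no : StrategyTree n}
    (h : ∀ l ∈ (node i yes no).leaves, P l) :
    (∀ l ∈ yes.leaves, P ((i, true) :: l)) ∧ ∀ l ∈ no.leaves, P ((i, false) :: l) := by
  simp only [leaves, List.mem_append, List.mem_map] at h
  exact ⟨fun l hl => h _ (Or.inl ⟨l, hl, rfl⟩), fun l hl => h _ (Or.inr ⟨l, hl, rfl⟩)⟩

/-- The expectation over the fresh sample is at most the maximum over the paths. -/
theorem jointExp_snd_le (h0 : ∀ i, 0 ≤ p i) (h1 : ∀ i, p i ≤ 1) (T : StrategyTree n) :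
    ∀ {h : Finset (Fin n) → ℝ} {c : ℝ}, (∀ l ∈ T.leaves, listExp p l.elements h ≤ c) →
      jointExp p T (fun _ R => h R) ≤ c := by
  induction T with
  | leaf => intro h c hc; exact hc [] (by simp [leaves])
  | node i yes no ihy ihn =>
    intro h c hc
    obtain ⟨hy, hn⟩ := forall_leaves_node hc
    -- The fresh state of `i` does not affect the arc taken, so it can be averaged into the function
    -- passed to both subtrees.
    have e : ∀ s, listExp p s (fun R => p i * h (insert i R) + (1 - p i) * h R) =
        listExp p (i :: s) h := fun s => by
      rw [listExp_add, listExp_const_mul, listExp_const_mul, listExp]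
    have by1 := ihy (h := fun R => p i * h (insert i R) + (1 - p i) * h R) (c := c)
      fun l hl => (e _).trans_le (hy l hl)
    have bn1 := ihn (h := fun R => p i * h (insert i R) + (1 - p i) * h R) (c := c)
      fun l hl => (e _).trans_le (hn l hl)
    rw [jointExp_add, jointExp_const_mul, jointExp_const_mul] at by1 bn1
    simp only [jointExp]
    calc _ ≤ p i * c + (1 - p i) * c :=
          add_le_add (mul_le_mul_of_nonneg_left by1 (h0 i))
            (mul_le_mul_of_nonneg_left bn1 (sub_nonneg.2 (h1 i)))
      _ = c := by ring

/-- The expected weight found by a tree is at most the largest compensator along a path. -/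
theorem jointExp_sum_fst_le (h0 : ∀ i, 0 ≤ p i) (h1 : ∀ i, p i ≤ 1) {u : Fin n → ℝ}
    (hu : ∀ i, 0 ≤ u i) (T : StrategyTree n) :
    ∀ {c : ℝ}, (∀ l ∈ T.leaves, (l.elements.map fun i => p i * u i).sum ≤ c) →
      jointExp p T (fun A _ => ∑ i ∈ A, u i) ≤ c := by
  induction T with
  | leaf => intro c hc; simpa [jointExp, ProbePath.elements, leaves] using hc
  | node i yes no ihy ihn =>
    intro c hc
    obtain ⟨hy, hn⟩ := forall_leaves_node hc
    -- Probing `i` spends `p i * u i` of the budget on both arcs and gains at most `u i` with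
    -- probability `p i`.
    have by1 := ihy (c := c - p i * u i) fun l hl => by
      have := hy l hl
      simp only [ProbePath.elements, List.map_cons, List.sum_cons] at this ⊢
      linarith
    have bn1 := ihn (c := c - p i * u i) fun l hl => by
      have := hn l hl
      simp only [ProbePath.elements, List.map_cons, List.sum_cons] at this ⊢
      linarith
    have by2 : jointExp p yes (fun A _ => ∑ j ∈ insert i A, u j) ≤ c - p i * u i + u i := by
      calc _ ≤ jointExp p yes (fun A _ => ∑ j ∈ A, u j + u i) := by
            refine jointExp_mono h0 h1 yes fun A _ => ?_
            by_cases hi : i ∈ A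
            · rw [insert_eq_of_mem hi]; linarith [hu i]
            · rw [sum_insert hi, add_comm]
        _ ≤ _ := by rw [jointExp_add, jointExp_const]; linarith
    simp only [jointExp]
    have a1 := mul_le_mul_of_nonneg_left by2 (h0 i)
    have a2 := mul_le_mul_of_nonneg_left bn1 (sub_nonneg.2 (h1 i))
    linarith

end StrategyTree

/-! ### Rank functions of set families -/

section Coverage

variable {n W : ℕ}

/-- The largest intersection of `A` with a member of the family `F` that contains `G`. -/
def coverRank (F : Fin W → Finset (Fin n)) (G A : Finset (Fin n)) : ℕ :=
  (univ.filter fun k => G ⊆ F k).sup fun k => #(F k ∩ A)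

theorem card_le_coverRank (F : Fin W → Finset (Fin n)) {G : Finset (Fin n)}
    (A : Finset (Fin n)) {k : Fin W} (hk : G ⊆ F k) : #(F k ∩ A) ≤ coverRank F G A :=
  le_sup (f := fun k => #(F k ∩ A)) (mem_filter.2 ⟨mem_univ k, hk⟩)

theorem coverRank_le {F : Fin W → Finset (Fin n)} {G A : Finset (Fin n)} {m : ℕ}
    (h : ∀ k, G ⊆ F k → #(F k ∩ A) ≤ m) : coverRank F G A ≤ m :=
  Finset.sup_le fun k hk => h k (mem_filter.1 hk).2

theorem card_inter_insert_le (S A : Finset (Fin n)) (i : Fin n) :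
    #(S ∩ insert i A) ≤ #(S ∩ A) + 1 := by
  by_cases hi : i ∈ S
  · rw [inter_insert_of_mem hi]; exact card_insert_le _ _
  · rw [inter_insert_of_notMem hi]; exact Nat.le_succ _

theorem coverRank_insert_le (F : Fin W → Finset (Fin n)) (G A : Finset (Fin n)) (i : Fin n) :
    coverRank F G (insert i A) ≤ coverRank F G A + 1 :=
  coverRank_le fun _ hk =>
    (card_inter_insert_le _ _ _).trans (Nat.succ_le_succ (card_le_coverRank F A hk))

/-- If no member that attains the rank of `A` contains `i`, then adding `i` leaves the rank. -/
theorem coverRank_insert_le_self {F : Fin W → Finset (Fin n)} {G A : Finset (Fin n)} {i : Fin n}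
    (h : ¬ ∃ k, insert i G ⊆ F k ∧ coverRank F G A ≤ #(F k ∩ A)) :
    coverRank F G (insert i A) ≤ coverRank F G A := by
  refine coverRank_le fun k hk => ?_
  by_cases hi : i ∈ F k
  · have : #(F k ∩ A) < coverRank F G A := by
      by_contra hc
      exact h ⟨k, insert_subset hi hk, not_lt.1 hc⟩
    exact (card_inter_insert_le _ _ _).trans this
  · rw [inter_insert_of_notMem hi]; exact card_le_coverRank F A hk

open StrategyTree in
/-- The exponential moment of the rank of the active elements, discounted by the rank of the fresh
sample, is at most a sum over the sets that a fresh sample may contain. -/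
theorem jointExp_two_pow_coverRank_le {p : Fin n → ℝ} (h0 : ∀ i, 0 ≤ p i) (h1 : ∀ i, p i ≤ 1)
    [Nonempty (Fin W)] (F : Fin W → Finset (Fin n)) (T : StrategyTree n) :
    ∀ (V A₀ : Finset (Fin n)) (φ ψ : Finset (Fin n) → ℝ),
      (∀ l ∈ T.leaves, l.elements.Nodup ∧ ∀ x ∈ l.elements, x ∈ V) → (∀ G, 0 ≤ φ G) →
      (∀ G R k, G ⊆ F k → G ⊆ R → ψ R ≤ φ G) →
      jointExp p T (fun A R => 2 ^ coverRank F ∅ (A₀ ∪ A) * ψ R) ≤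
        ∑ G ∈ V.powerset, φ G * (2 ^ #G * 2 ^ coverRank F G A₀) := by
  induction T with
  | leaf =>
    intro V A₀ φ ψ _ hφ hψ
    obtain ⟨k₀⟩ := ‹Nonempty (Fin W)›
    have h := single_le_sum (f := fun G => φ G * (2 ^ #G * 2 ^ coverRank F G A₀))
      (fun G _ => mul_nonneg (hφ G) (by positivity)) (empty_mem_powerset V)
    refine le_trans ?_ h
    simp only [jointExp, union_empty, card_empty, pow_zero, one_mul]
    rw [mul_comm]
    exact mul_le_mul_of_nonneg_right (hψ ∅ ∅ k₀ (empty_subset _) (empty_subset _)) (by positivity)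
  | node i yes no ihy ihn =>
    intro V A₀ φ ψ hT hφ hψ
    classical
    obtain ⟨hy, hn⟩ := forall_leaves_node hT
    have hiV : i ∈ V := by
      obtain ⟨l, hl⟩ := List.exists_mem_of_ne_nil _ yes.leaves_ne_nil
      exact (hy l hl).2 i (by simp [ProbePath.elements])
    have side : ∀ {T' : StrategyTree n} {b : Bool}, (∀ l ∈ T'.leaves,
        (ProbePath.elements ((i, b) :: l)).Nodup ∧
          ∀ x ∈ ProbePath.elements ((i, b) :: l), x ∈ V) →
        ∀ l ∈ T'.leaves, l.elements.Nodup ∧ ∀ x ∈ l.elements, x ∈ V.erase i := by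
      intro T' b h l hl
      obtain ⟨a, a'⟩ := h l hl
      simp only [ProbePath.elements, List.map_cons] at a a' ⊢
      obtain ⟨b1, b2⟩ := List.nodup_cons.1 a
      exact ⟨b2, fun x hx => mem_erase.2 ⟨fun e => b1 (e ▸ hx), a' x (List.mem_cons_of_mem _ hx)⟩⟩
    -- A hit means that `i` may raise the rank relative to `G`, and also that adding `i` to `G` does
    -- not lower this rank. Only then is an active fresh state of `i` recorded in `G`.
    let hit : Finset (Fin n) → Prop := fun G =>
      ∃ k, insert i G ⊆ F k ∧ coverRank F G A₀ ≤ #(F k ∩ A₀)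
    let φ₁ : Finset (Fin n) → ℝ := fun G => if hit G then φ (insert i G) else φ G
    have hφ₁ : ∀ G, 0 ≤ φ₁ G := fun G => by simp only [φ₁]; split_ifs <;> exact hφ _
    have hψ₁ : ∀ G R k, G ⊆ F k → G ⊆ R → ψ (insert i R) ≤ φ₁ G := by
      intro G R k hk hR
      simp only [φ₁]
      split_ifs with hG
      · obtain ⟨k', hk', -⟩ := hG
        exact hψ _ _ k' hk' (insert_subset_insert i hR)
      · exact hψ _ _ k hk (hR.trans (subset_insert i R))
    have y1 := ihy (V.erase i) (insert i A₀) φ₁ (fun R => ψ (insert i R)) (side hy) hφ₁ hψ₁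
    have y0 := ihy (V.erase i) (insert i A₀) φ ψ (side hy) hφ hψ
    have n1 := ihn (V.erase i) A₀ φ₁ (fun R => ψ (insert i R)) (side hn) hφ₁ hψ₁
    have n0 := ihn (V.erase i) A₀ φ ψ (side hn) hφ hψ
    have q0 := h0 i
    have q1 := sub_nonneg.2 (h1 i)
    simp only [insert_union] at y1 y0
    simp only [jointExp, union_insert]
    rw [← insert_erase hiV, sum_powerset_insert (notMem_erase i V)]
    calc _ ≤ _ := add_le_add
            (mul_le_mul_of_nonneg_left (add_le_add (mul_le_mul_of_nonneg_left y1 q0)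
              (mul_le_mul_of_nonneg_left y0 q1)) q0)
            (mul_le_mul_of_nonneg_left (add_le_add (mul_le_mul_of_nonneg_left n1 q0)
              (mul_le_mul_of_nonneg_left n0 q1)) q1)
      _ ≤ _ := by
        simp only [mul_sum, ← sum_add_distrib]
        refine sum_le_sum fun G hG => ?_
        have hiG : i ∉ G := fun hh => notMem_erase i V (mem_powerset.1 hG hh)
        have c1 : (0 : ℝ) ≤ 2 ^ #G * 2 ^ coverRank F G A₀ := by positivity
        have f0 := hφ G
        have f1 := hφ (insert i G)
        rw [card_insert_of_notMem hiG]
        by_cases hh : hit G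
        · have hr : (2 : ℝ) ^ coverRank F G (insert i A₀) ≤ 2 * 2 ^ coverRank F G A₀ := by
            rw [← pow_succ']
            exact pow_le_pow_right₀ one_le_two (coverRank_insert_le F G A₀ i)
          have hr' : (2 : ℝ) ^ coverRank F G A₀ ≤ 2 ^ coverRank F (insert i G) A₀ := by
            obtain ⟨k, hk, hk'⟩ := hh
            exact pow_le_pow_right₀ one_le_two (hk'.trans (card_le_coverRank F A₀ hk))
          simp only [φ₁, if_pos hh]
          calc _ = (p i * φ (insert i G) + (1 - p i) * φ G) * 2 ^ #G *
                (p i * 2 ^ coverRank F G (insert i A₀) +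
                  (1 - p i) * 2 ^ coverRank F G A₀) := by ring
            _ ≤ (p i * φ (insert i G) + (1 - p i) * φ G) * 2 ^ #G *
                (p i * (2 * 2 ^ coverRank F G A₀) + (1 - p i) * 2 ^ coverRank F G A₀) := by
              gcongr
            -- Base 2 gives the growth factor 1 + p, and (1 - p)(1 + p) ≤ 1. The other coefficient
            -- p(1 + p) ≤ 2 is paid for by the extra factor 2 in `2 ^ #(insert i G)`.
            _ = (1 - p i * p i) * (φ G * (2 ^ #G * 2 ^ coverRank F G A₀)) +
                (p i * (1 + p i)) * (φ (insert i G) * (2 ^ #G * 2 ^ coverRank F G A₀)) := by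
              ring
            _ ≤ 1 * (φ G * (2 ^ #G * 2 ^ coverRank F G A₀)) +
                2 * (φ (insert i G) * (2 ^ #G * 2 ^ coverRank F (insert i G) A₀)) := by
              gcongr
              · nlinarith
              · nlinarith
            _ = _ := by rw [pow_succ]; ring
        · have hr : (2 : ℝ) ^ coverRank F G (insert i A₀) ≤ 2 ^ coverRank F G A₀ :=
            pow_le_pow_right₀ one_le_two (coverRank_insert_le_self hh)
          simp only [φ₁, if_neg hh]
          calc _ = φ G * 2 ^ #G * (p i * 2 ^ coverRank F G (insert i A₀) +
                  (1 - p i) * 2 ^ coverRank F G A₀) := by ring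
            _ ≤ φ G * 2 ^ #G * (p i * 2 ^ coverRank F G A₀ +
                  (1 - p i) * 2 ^ coverRank F G A₀) := by gcongr
            _ = φ G * (2 ^ #G * 2 ^ coverRank F G A₀) + 0 := by ring
            _ ≤ _ := by gcongr; positivity

open StrategyTree in
/-- The adaptivity bound for the rank function of a set family. -/
theorem jointExp_coverRank_le {p : Fin n → ℝ} (h0 : ∀ i, 0 ≤ p i) (h1 : ∀ i, p i ≤ 1)
    [Nonempty (Fin W)] (F : Fin W → Finset (Fin n)) (T : StrategyTree n)
    (hT : ∀ l ∈ T.leaves, l.elements.Nodup) (hn : 0 < n) :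
    Real.log 2 * jointExp p T (fun A _ => (coverRank F ∅ A : ℝ)) ≤
      Real.log (2 * n) * jointExp p T (fun _ R => (coverRank F ∅ R : ℝ)) + 2 := by
  have hn' : (1 : ℝ) ≤ n := by exact_mod_cast hn
  have hl0 : (0 : ℝ) ≤ (2 * n : ℝ)⁻¹ := by positivity
  have hl1 : (2 * n : ℝ)⁻¹ ≤ 1 := inv_le_one_of_one_le₀ (by linarith)
  -- With discount 1/(2n) each element of `G` weighs 1/n, so the sum over all `G` is (1 + 1/n)^n ≤
  -- e.
  have key := jointExp_two_pow_coverRank_le h0 h1 F T univ ∅ (fun G => (2 * n : ℝ)⁻¹ ^ #G)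
    (fun R => (2 * n : ℝ)⁻¹ ^ coverRank F ∅ R) (fun l hl => ⟨hT l hl, fun x _ => mem_univ x⟩)
    (fun G => by positivity) (fun G R k hk hR => by
      refine pow_le_pow_of_le_one hl0 hl1 (le_trans (card_le_card ?_)
        (card_le_coverRank F R (empty_subset (F k))))
      exact subset_inter hk hR)
  have hsum : ∑ G ∈ (univ : Finset (Fin n)).powerset,
      (2 * n : ℝ)⁻¹ ^ #G * (2 ^ #G * 2 ^ coverRank F G ∅) ≤ 3 := by
    have e : ∀ G : Finset (Fin n), (2 * n : ℝ)⁻¹ ^ #G * (2 ^ #G * 2 ^ coverRank F G ∅) =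
        (1 / n : ℝ) ^ #G * 1 ^ (n - #G) := fun G => by
      have : coverRank F G ∅ = 0 := Nat.le_zero.1 (coverRank_le fun k _ => by simp)
      rw [this, pow_zero, mul_one, ← mul_pow, one_pow, mul_one]
      congr 1
      field_simp
    simp only [e]
    have h2 := sum_pow_mul_eq_add_pow (1 / n : ℝ) 1 (univ : Finset (Fin n))
    rw [card_univ, Fintype.card_fin] at h2
    rw [h2]
    calc (1 / n + 1 : ℝ) ^ n ≤ Real.exp (1 / n) ^ n := by
          gcongr; exact Real.add_one_le_exp _
      _ = Real.exp 1 := by rw [← Real.exp_nat_mul]; congr 1; field_simp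
      _ ≤ 3 := by linarith [Real.exp_one_lt_d9]
  have hpt : ∀ A R : Finset (Fin n), Real.log 2 * (coverRank F ∅ A : ℝ) +
      (-Real.log (2 * n)) * (coverRank F ∅ R : ℝ) ≤
      2 ^ coverRank F ∅ (∅ ∪ A) * (2 * n : ℝ)⁻¹ ^ coverRank F ∅ R + (-1) := by
    intro A R
    rw [empty_union]
    have hpos : (0 : ℝ) < 2 ^ coverRank F ∅ A * (2 * n : ℝ)⁻¹ ^ coverRank F ∅ R := by positivity
    have h3 := Real.log_le_sub_one_of_pos hpos
    rw [Real.log_mul (by positivity) (by positivity), Real.log_pow, Real.log_pow,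
      Real.log_inv] at h3
    linarith
  have h4 := jointExp_mono h0 h1 T hpt
  rw [jointExp_add, jointExp_const_mul T _ (fun A _ => (coverRank F ∅ A : ℝ)),
    jointExp_const_mul T _ (fun _ R => (coverRank F ∅ R : ℝ)), jointExp_add,
    jointExp_const] at h4
  linarith

end Coverage

/-! ### Dyadic decomposition of an XOS function -/

section XOS

variable {n W : ℕ} {w : Fin W → Fin n → ℝ} {f : Finset (Fin n) → ℝ}

/-- A bounded weight is at most the sum of the dyadic scales below it. -/
theorem le_sum_dyadic {B x : ℝ} (hB : 0 ≤ B) (hx : x ≤ 2 * B) (M : ℕ) :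
    x ≤ ∑ i ∈ range M, (if B / 2 ^ i < x then 2 * B / 2 ^ i else 0) + 2 * B / 2 ^ M := by
  induction M with
  | zero => simpa using hx
  | succ M ih =>
    have hs : 0 ≤ ∑ i ∈ range M, (if B / 2 ^ i < x then 2 * B / 2 ^ i else 0) :=
      sum_nonneg fun i _ => by split_ifs <;> positivity
    have e : 2 * B / 2 ^ (M + 1) = B / 2 ^ M := by rw [pow_succ]; field_simp
    have h' : 0 ≤ B / 2 ^ M := by positivity
    rw [sum_range_succ, e]
    split_ifs with h
    · linarith
    · linarith [not_lt.1 h]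

/-- The elements whose weight under the `k`-th vector exceeds `c`. -/
noncomputable def heavy (w : Fin W → Fin n → ℝ) (c : ℝ) (k : Fin W) : Finset (Fin n) :=
  univ.filter fun j => c < w k j

theorem sum_le_of_isGreatest
    (hf : ∀ S : Finset (Fin n), IsGreatest (Set.range fun k => ∑ j ∈ S, w k j) (f S))
    (S : Finset (Fin n)) (k : Fin W) : ∑ j ∈ S, w k j ≤ f S :=
  (hf S).2 ⟨k, rfl⟩

theorem mul_coverRank_heavy_le (hw : ∀ k j, 0 ≤ w k j)
    (hf : ∀ S : Finset (Fin n), IsGreatest (Set.range fun k => ∑ j ∈ S, w k j) (f S))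
    {c : ℝ} (hc : 0 < c) (S : Finset (Fin n)) : c * coverRank (heavy w c) ∅ S ≤ f S := by
  have hS : ∀ k, c * #(heavy w c k ∩ S) ≤ f S := by
    intro k
    calc c * #(heavy w c k ∩ S) = ∑ j ∈ heavy w c k ∩ S, c := by
          rw [sum_const, nsmul_eq_mul, mul_comm]
      _ ≤ ∑ j ∈ heavy w c k ∩ S, w k j :=
          sum_le_sum fun j hj => (mem_filter.1 (mem_inter.1 hj).1).2.le
      _ ≤ ∑ j ∈ S, w k j :=
          sum_le_sum_of_subset_of_nonneg inter_subset_right fun j _ _ => hw k j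
      _ ≤ f S := sum_le_of_isGreatest hf S k
  have h0 : 0 ≤ f S := by
    obtain ⟨k, hk⟩ := (hf S).1
    exact hk ▸ sum_nonneg fun j _ => hw k j
  rw [mul_comm, ← le_div_iff₀ hc]
  have : coverRank (heavy w c) ∅ S ≤ ⌊f S / c⌋₊ := by
    refine coverRank_le fun k _ => Nat.le_floor ?_
    rw [le_div_iff₀ hc, mul_comm]
    exact hS k
  exact (Nat.cast_le.2 this).trans (Nat.floor_le (by positivity))

/-- The value of an element if it exceeds `c`, and zero otherwise. -/
noncomputable def largeValue (f : Finset (Fin n) → ℝ) (c : ℝ) (j : Fin n) : ℝ :=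
  if c < f {j} then f {j} else 0

/-- Each weight is at most the singleton value, so large weights are dominated by an additive
function that does not depend on the maximizing vector. Only the dyadic scales need a maximum over
vectors. -/
theorem le_largeValue_add_dyadic
    (hf : ∀ S : Finset (Fin n), IsGreatest (Set.range fun k => ∑ j ∈ S, w k j) (f S))
    {B : ℝ} (hB : 0 ≤ B) (M : ℕ) (S : Finset (Fin n)) :
    f S ≤ ∑ j ∈ S, (largeValue f (2 * B) j + 2 * B / 2 ^ M) +
      ∑ i ∈ range M, 2 * B / 2 ^ i * coverRank (heavy w (B / 2 ^ i)) ∅ S := by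
  obtain ⟨k, hk⟩ := (hf S).1
  have hj : ∀ j, w k j ≤ largeValue f (2 * B) j + 2 * B / 2 ^ M +
      ∑ i ∈ range M, (if B / 2 ^ i < w k j then 2 * B / 2 ^ i else 0) := by
    intro j
    have hkj : w k j ≤ f {j} := by simpa using sum_le_of_isGreatest hf {j} k
    unfold largeValue
    split_ifs with h
    · have : 0 ≤ ∑ i ∈ range M, (if B / 2 ^ i < w k j then 2 * B / 2 ^ i else 0) :=
        sum_nonneg fun i _ => by split_ifs <;> positivity
      have : 0 ≤ 2 * B / 2 ^ M := by positivity
      linarith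
    · linarith [le_sum_dyadic hB (hkj.trans (not_lt.1 h)) M]
  calc f S = ∑ j ∈ S, w k j := hk.symm
    _ ≤ ∑ j ∈ S, (largeValue f (2 * B) j + 2 * B / 2 ^ M +
      ∑ i ∈ range M, (if B / 2 ^ i < w k j then 2 * B / 2 ^ i else 0)) :=
        sum_le_sum fun j _ => hj j
    _ = ∑ j ∈ S, (largeValue f (2 * B) j + 2 * B / 2 ^ M) +
      ∑ i ∈ range M, ∑ j ∈ S, (if B / 2 ^ i < w k j then 2 * B / 2 ^ i else 0) := by
        rw [sum_add_distrib, sum_comm]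
    _ ≤ _ := by
        gcongr with i hi
        rw [← sum_filter, sum_const, nsmul_eq_mul, mul_comm]
        gcongr
        refine le_trans (card_le_card fun j hj => ?_)
          (card_le_coverRank (heavy w (B / 2 ^ i)) S (empty_subset (heavy w (B / 2 ^ i) k)))
        obtain ⟨h1, h2⟩ := mem_filter.1 hj
        exact mem_inter.2 ⟨mem_filter.2 ⟨mem_univ j, h2⟩, h1⟩

/-- If the expected value of a list is at most `B`, then the expected number of active elements of
value above `2 * B`, weighted by value, is at most `2 * B`. -/
theorem sum_mul_largeValue_le {p : Fin n → ℝ} (h0 : ∀ i, 0 ≤ p i) (h1 : ∀ i, p i ≤ 1)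
    (hw : ∀ k j, 0 ≤ w k j)
    (hf : ∀ S : Finset (Fin n), IsGreatest (Set.range fun k => ∑ j ∈ S, w k j) (f S))
    {B : ℝ} (hB : 0 < B) (s : List (Fin n)) (hs : listExp p s f ≤ B) :
    (s.map fun j => p j * largeValue f (2 * B) j).sum ≤ 2 * B := by
  have hmono : ∀ S S' : Finset (Fin n), S ⊆ S' → f S ≤ f S' := by
    intro S S' h
    obtain ⟨k, hk⟩ := (hf S).1
    calc f S = ∑ j ∈ S, w k j := hk.symm
      _ ≤ ∑ j ∈ S', w k j := sum_le_sum_of_subset_of_nonneg h fun j _ _ => hw k j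
      _ ≤ f S' := sum_le_of_isGreatest hf S' k
  have hpos : ∀ S, 0 ≤ f S := fun S => by
    obtain ⟨k, hk⟩ := (hf S).1
    exact hk ▸ sum_nonneg fun j _ => hw k j
  -- Here `q` is the probability that no large element is active. Otherwise the reward exceeds 2B,
  -- which forces `q ≥ 1/2`. Crediting only the first active large element gives at least `q` times
  -- the weighted sum.
  have key : ∀ s : List (Fin n), ∃ q : ℝ, 0 ≤ q ∧ q ≤ 1 ∧ 2 * B * (1 - q) ≤ listExp p s f ∧
      q * (s.map fun j => p j * largeValue f (2 * B) j).sum ≤ listExp p s f ∧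
      0 ≤ (s.map fun j => p j * largeValue f (2 * B) j).sum := by
    intro s
    induction s with
    | nil => exact ⟨1, by norm_num, le_rfl, by simpa [listExp] using hpos ∅,
        by simpa [listExp] using hpos ∅, by simp⟩
    | cons j s ih =>
      obtain ⟨q, hq0, hq1, ha, hb, hd⟩ := ih
      have p0 := h0 j
      have p1 := sub_nonneg.2 (h1 j)
      simp only [List.map_cons, List.sum_cons, listExp]
      set D := (s.map fun j => p j * largeValue f (2 * B) j).sum
      by_cases h : 2 * B < f {j}
      · have e : listExp p s (fun _ => f {j}) ≤ listExp p s (fun R => f (insert j R)) :=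
          listExp_mono h0 h1 s fun R => hmono _ _ (by simp)
        rw [listExp_const] at e
        have hl : largeValue f (2 * B) j = f {j} := if_pos h
        have e1 := mul_le_mul_of_nonneg_left e p0
        have e2 := mul_le_mul_of_nonneg_left ha p1
        have e3 := mul_le_mul_of_nonneg_left hb p1
        have e4 := mul_le_mul_of_nonneg_left h.le p0
        have e5 : (1 - p j) * q ≤ 1 := by nlinarith
        have e6 : 0 ≤ p j * f {j} := mul_nonneg p0 (hpos _)
        refine ⟨(1 - p j) * q, by positivity, e5, by nlinarith, ?_, by rw [hl]; positivity⟩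
        rw [hl]
        nlinarith [mul_le_mul_of_nonneg_right e5 e6]
      · have e : listExp p s f ≤ listExp p s (fun R => f (insert j R)) :=
          listExp_mono h0 h1 s fun R => hmono _ _ (subset_insert j R)
        have hl : largeValue f (2 * B) j = 0 := if_neg h
        have e1 := mul_le_mul_of_nonneg_left e p0
        refine ⟨q, hq0, hq1, by linarith, ?_, by rw [hl]; linarith⟩
        rw [hl, mul_zero, zero_add]
        linarith
  obtain ⟨q, hq0, hq1, ha, hb, hd⟩ := key s
  have hq : 1 / 2 ≤ q := by nlinarith
  nlinarith

end XOS

/-! ### The adaptivity gap -/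

namespace BernoulliProbing

variable {n : ℕ} (I : BernoulliProbing n)

theorem adap_eq_jointExp (T : StrategyTree n) :
    I.adap T = T.jointExp I.p (fun A _ => I.f A) :=
  T.sum_leaves_eq_jointExp I.f

open StrategyTree in
/-- The adaptive reward of an XOS function is bounded by the largest non-adaptive reward. -/
theorem adap_le_of_nonadap_le (hf : IsXOS I.f) {r : ℕ} (hr : 2 ≤ r) (hrn : r ≤ n)
    (hlen : ∀ s ∈ I.feasible, s.length ≤ r) {B : ℝ} (hB : 0 < B)
    (hna : ∀ s ∈ I.feasible, I.nonadap s ≤ B) {T : StrategyTree n}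
    (hT : I.IsAdaptiveStrategy T) :
    I.adap T ≤ 24 * Real.logb 2 r * Real.logb 2 n * B := by
  obtain ⟨W, w, hw, hfw⟩ := hf
  have : Nonempty (Fin W) := ⟨(hfw ∅).1.choose⟩
  have h0 := I.p_nonneg
  have h1 := I.p_le_one
  have hl : ∀ l ∈ T.leaves, listExp I.p l.elements I.f ≤ B := fun l hl => by
    rw [← nonadap_eq_listExp I (I.nodup _ (hT l hl))]
    exact hna _ (hT l hl)
  -- Chosen so that `2 ^ M ≥ r`: at most `r` remainders of size 2B/2^M then cost at most 2B.
  set M := Nat.log 2 r + 1 with hM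
  have hrM : (r : ℝ) ≤ 2 ^ M := by
    exact_mod_cast (Nat.lt_pow_succ_log_self one_lt_two r).le
  have hlogr : (1 : ℝ) ≤ Real.logb 2 r := by
    rw [Real.le_logb_iff_rpow_le one_lt_two (by positivity)]
    simpa using hr
  have hlogn : (1 : ℝ) ≤ Real.logb 2 n := by
    rw [Real.le_logb_iff_rpow_le one_lt_two (by exact_mod_cast (by omega : 0 < n))]
    simpa using hr.trans hrn
  have hMr : (M : ℝ) ≤ 2 * Real.logb 2 r := by
    have := Real.natLog_le_logb r 2
    push_cast [hM] at this ⊢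
    linarith
  have hpart1 : jointExp I.p T (fun A _ => ∑ j ∈ A, (largeValue I.f (2 * B) j + 2 * B / 2 ^ M)) ≤
      4 * B := by
    refine jointExp_sum_fst_le h0 h1 (fun j => ?_) T fun l hl' => ?_
    · have : 0 ≤ largeValue I.f (2 * B) j := by
        unfold largeValue
        split_ifs with h
        · linarith
        · exact le_rfl
      positivity
    · have hbig := sum_mul_largeValue_le h0 h1 hw hfw hB l.elements (hl l hl')
      have hsmall : (l.elements.map fun j => I.p j * (2 * B / 2 ^ M)).sum ≤ 2 * B := by
        calc _ ≤ (l.elements.map fun j => I.p j * (2 * B / 2 ^ M)).length •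
                (2 * B / 2 ^ M) := by
              refine List.sum_le_card_nsmul _ _ fun x hx => ?_
              obtain ⟨j, -, rfl⟩ := List.mem_map.1 hx
              exact mul_le_of_le_one_left (by positivity) (h1 j)
          _ ≤ 2 ^ M * (2 * B / 2 ^ M) := by
              rw [List.length_map, nsmul_eq_mul]
              gcongr
              exact le_trans (by exact_mod_cast hlen _ (hT l hl')) hrM
          _ = 2 * B := by field_simp
      simp only [mul_add, List.sum_map_add]
      linarith
  have hscale : ∀ i ∈ range M, 2 * B / 2 ^ i *
      jointExp I.p T (fun A _ => (coverRank (heavy w (B / 2 ^ i)) ∅ A : ℝ)) ≤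
        10 * Real.logb 2 n * B := by
    intro i _
    have hc : 0 < B / 2 ^ i := by positivity
    -- Each unit of rank is worth at least B/2^i, and the fresh sample has mean value at most `B`.
    have hR : jointExp I.p T (fun _ R => (coverRank (heavy w (B / 2 ^ i)) ∅ R : ℝ)) ≤ 2 ^ i := by
      refine jointExp_snd_le h0 h1 T fun l hl' => ?_
      have h2 := listExp_mono h0 h1 l.elements (mul_coverRank_heavy_le hw hfw hc)
      rw [listExp_const_mul _ _ (fun S => (coverRank (heavy w (B / 2 ^ i)) ∅ S : ℝ))] at h2
      have h3 := h2.trans (hl l hl')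
      rw [div_mul_eq_mul_div, div_le_iff₀ (by positivity)] at h3
      exact le_of_mul_le_mul_left h3 hB
    have hA := jointExp_coverRank_le h0 h1 (heavy w (B / 2 ^ i)) T
      (fun l hl' => I.nodup _ (hT l hl')) (by omega)
    set E := jointExp I.p T (fun A _ => (coverRank (heavy w (B / 2 ^ i)) ∅ A : ℝ))
    have hn : (1 : ℝ) ≤ n := by exact_mod_cast (by omega : 1 ≤ n)
    have hlog : Real.log (2 * n) = Real.log 2 * (1 + Real.logb 2 n) := by
      rw [Real.log_mul two_ne_zero (by positivity), Real.logb]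
      have := (Real.log_pos one_lt_two).ne'
      field_simp
    have l2 := Real.log_two_gt_d9
    have hE : E ≤ 5 * Real.logb 2 n * 2 ^ i := by
      have hp : (1 : ℝ) ≤ 2 ^ i := one_le_pow₀ one_le_two
      -- The additive 2 is absorbed by 3 log 2 > 2.
      have h4 : Real.log 2 * E ≤ Real.log 2 * ((1 + Real.logb 2 n) * 2 ^ i + 3) := by
        have h5 := mul_le_mul_of_nonneg_left hR
          (Real.log_nonneg (by linarith : (1 : ℝ) ≤ 2 * n))
        rw [hlog] at h5 hA
        nlinarith
      have h6 := le_of_mul_le_mul_left h4 (Real.log_pos one_lt_two)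
      nlinarith
    calc 2 * B / 2 ^ i * E ≤ 2 * B / 2 ^ i * (5 * Real.logb 2 n * 2 ^ i) := by gcongr
      _ = 10 * Real.logb 2 n * B := by field_simp; ring
  have hfA := jointExp_mono h0 h1 T
    (fun A _ => le_largeValue_add_dyadic hfw hB.le M A)
  rw [jointExp_add T (fun A _ => ∑ j ∈ A, (largeValue I.f (2 * B) j + 2 * B / 2 ^ M)),
    jointExp_sum] at hfA
  simp only [jointExp_const_mul T _ (fun A _ => (coverRank (heavy w (B / 2 ^ _)) ∅ A : ℝ))] at hfA
  have hsum := sum_le_sum hscale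
  rw [sum_const, card_range, nsmul_eq_mul] at hsum
  rw [adap_eq_jointExp]
  -- At most 2 log r scales cost 10 B log n each; with 4B for the additive part this makes 24.
  have h7 : (M : ℝ) * (10 * Real.logb 2 n * B) ≤
      2 * Real.logb 2 r * (10 * Real.logb 2 n * B) := by gcongr
  have h8 : 4 * B ≤ 4 * (Real.logb 2 r * Real.logb 2 n) * B := by
    have := one_le_mul_of_one_le_of_one_le hlogr hlogn
    nlinarith
  linarith

/-- The adaptivity gap of an XOS function. -/
theorem adaptivityGap_le (hf : IsXOS I.f) {r : ℕ} (hr : 2 ≤ r) (hrn : r ≤ n)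
    (hlen : ∀ s ∈ I.feasible, s.length ≤ r) :
    I.adaptivityGap ≤ ENNReal.ofReal (24 * Real.logb 2 r * Real.logb 2 n) := by
  by_cases htop : I.optNonadap = ⊤
  · simp [adaptivityGap, htop]
  set K : ℝ := 24 * Real.logb 2 r * Real.logb 2 n with hK
  have hK0 : 0 ≤ K := by
    have h1 : (1 : ℝ) ≤ r := by exact_mod_cast (by omega : 1 ≤ r)
    have h2 : (1 : ℝ) ≤ n := by exact_mod_cast (by omega : 1 ≤ n)
    have := Real.logb_nonneg one_lt_two h1
    have := Real.logb_nonneg one_lt_two h2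
    positivity
  refine ENNReal.div_le_of_le_mul (iSup₂_le fun T hT => ?_)
  have hna : ∀ s ∈ I.feasible, I.nonadap s ≤ I.optNonadap.toReal := fun s hs =>
    (ENNReal.ofReal_le_iff_le_toReal htop).1
      (le_iSup₂ (f := fun s (_ : s ∈ I.feasible) => ENNReal.ofReal (I.nonadap s)) s hs)
  -- The non-adaptive optimum may be 0, while the scales need a positive `B`; hence `B` is the
  -- optimum plus ε, with ε → 0.
  have hle : I.adap T ≤ K * I.optNonadap.toReal := by
    have hlim : Filter.Tendsto (fun ε : ℝ => K * (I.optNonadap.toReal + ε))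
        (nhdsWithin 0 (Set.Ioi 0)) (nhds (K * (I.optNonadap.toReal + 0))) :=
      Filter.Tendsto.mono_left (Continuous.tendsto (by fun_prop) 0) nhdsWithin_le_nhds
    rw [add_zero] at hlim
    refine ge_of_tendsto hlim (eventually_nhdsWithin_of_forall fun ε hε => ?_)
    have hε' : (0 : ℝ) < ε := hε
    exact I.adap_le_of_nonadap_le hf hr hrn hlen
      (add_pos_of_nonneg_of_pos ENNReal.toReal_nonneg hε')
      (fun s hs => (hna s hs).trans (by linarith)) hT
  calc ENNReal.ofReal (I.adap T) ≤ ENNReal.ofReal (K * I.optNonadap.toReal) :=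
        ENNReal.ofReal_le_ofReal hle
    _ = ENNReal.ofReal K * I.optNonadap := by
        rw [ENNReal.ofReal_mul hK0, ENNReal.ofReal_toReal htop]

end BernoulliProbing

theorem mainTheorem6 :
    ∃ C : ℝ, 0 < C ∧ ∀ n r : ℕ, 2 ≤ r → r ≤ n →
      gapXOS n r ≤ ENNReal.ofReal (C * Real.logb 2 r * Real.logb 2 n) :=
  ⟨24, by norm_num, fun _ _ hr hrn =>
    iSup_le fun I => iSup₂_le fun hf hlen => I.adaptivityGap_le hf hr hrn hlen⟩
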